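/- Let $n\ge 1$ and $0\le m\le n$ be integers, and let $C\in\mathbb R^{n,n}$ be a nonsingular cyclops with eye $m+$ and parameters $a_1,\dots,a_n,b_1,b_2\in\mathbb R$. That is, $a_1>a_2>\dots>a_m$, $a_n>a_{n-1}>\dots>a_{m+1}$, and $$c_{ij}=\begin{cases}a_{\max\{i,j\}} & i,j\le m,\\ b_1 & i\le m<j,\\ b_2 & j\le m<i,\\ a_{\min\{i,j\}} & i,j\ge m+1.\end{cases}$$ Assume that $C^{-1}$ is a Z-matrix, i.e. that all its off-diagonal entries are $\le 0$. For $0\le s\le n$ let $L_s$ be the set of all matrices $tI-B\in\mathbb R^{n,n}$ such that $t\in\mathbb R$, $B$ is entrywise nonnegative, and $\rho_s(B)\le t<\rho_{s+1}(B)$. Here $\rho_s(B)$ is the maximum of the spectral radii of the $s\times s$ principal submatrices of $B$ for $1\le s\le n$, with $\rho_0=-\infty$ and $\rho_{n+1}=\infty$. An M-matrix is a matrix $tI-B$ with $B$ entrywise nonnegative and $\rho(B)=\rho_n(B)\le t$. Put $$\chi=\{k-j : a_ja_k-b_1b_2<0,\ j\le m,\ k\ge m+1\},\qquad \Upsilon=\{k-j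 : a_ja_k-b_1b_2>0,\ j\le m,\ k\ge m+1\}.$$ Let $x=\min\chi$ if $\chi\ne\emptyset$ and $x=n+1$ otherwise. Let $y=\min\Upsilon$ if $\Upsilon\neq\emptyset$ and $y=n+1$ otherwise. Let $r$ be the number of positive $a_j$ with $j\le m$, and $t$ the number of positive $a_j$ with $j>m$. Then: (i) If $\det C>0$ and $a_m>0$ (the latter condition being dropped if $m=0$), then $C^{-1}\in L_n$, i.e. $C$ is an inverse M-matrix. (ii) If $\det C>0$, $m\ge 1$ and $a_m\le 0$, then $C^{-1}\in L_s$ with $s=n-1-\max\{m,\,n-m,\,n-x+1\}$. (iii) If $\det C<0$, then $C^{-1}\in L_s$ with $s=n-1-\max\{r,\,t,\,n-y+1\}$. -/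

import Mathlib

open scoped ENNReal

noncomputable section

/-- A real square matrix is a Z-matrix if its off-diagonal entries are nonpositive. -/
def IsZMatrix {n : ℕ} (A : Matrix (Fin n) (Fin n) ℝ) : Prop :=
  ∀ i j, i ≠ j → A i j ≤ 0

/-- The spectral radius (over the complex numbers) of the principal submatrix of `B` whose rows
and columns are indexed by `S`. -/
def principalSpectralRadius {n : ℕ} (B : Matrix (Fin n) (Fin n) ℝ) (S : Finset (Fin n)) : ℝ≥0∞ :=
  spectralRadius ℂ
    ((B.submatrix (fun i : S => (i : Fin n)) (fun j : S => (j : Fin n))).map (fun r : ℝ => (r : ℂ)))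

open Classical in
/-- `rhoSub s B` is the maximum of the spectral radii of the `s × s` principal submatrices of `B`
for `1 ≤ s ≤ n`, with the conventions `-∞` for `s = 0` and `∞` for `s > n`. -/
def rhoSub {n : ℕ} (s : ℕ) (B : Matrix (Fin n) (Fin n) ℝ) : EReal :=
  if s = 0 then ⊥
  else if n < s then ⊤
  else ⨆ S : {S : Finset (Fin n) // S.card = s}, ((principalSpectralRadius B S.1 : ℝ≥0∞) : EReal)

/-- The class `L_s`: matrices `t I - B` with `B` entrywise nonnegative and
`ρ_s(B) ≤ t < ρ_{s+1}(B)`, where `0 ≤ s ≤ n`. -/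
def InClassL {n : ℕ} (s : ℕ) (A : Matrix (Fin n) (Fin n) ℝ) : Prop :=
  s ≤ n ∧ ∃ (t : ℝ) (B : Matrix (Fin n) (Fin n) ℝ),
    (∀ i j, 0 ≤ B i j) ∧ A = t • (1 : Matrix (Fin n) (Fin n) ℝ) - B ∧
      rhoSub s B ≤ (t : EReal) ∧ (t : EReal) < rhoSub (s + 1) B

/-- M-matrices: matrices `t I - B` with `B` entrywise nonnegative and `ρ(B) ≤ t`. -/
def IsMMatrix {n : ℕ} (A : Matrix (Fin n) (Fin n) ℝ) : Prop :=
  ∃ (t : ℝ) (B : Matrix (Fin n) (Fin n) ℝ),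
    (∀ i j, 0 ≤ B i j) ∧ A = t • (1 : Matrix (Fin n) (Fin n) ℝ) - B ∧
      ((principalSpectralRadius B Finset.univ : ℝ≥0∞) : EReal) ≤ (t : EReal)

/-- `C` is a cyclops with eye `m+` and parameters `a`, `b₁`, `b₂`. Indices are shifted by one:
the parameter `a_i` of the usual notation, `1 ≤ i ≤ n`, is `a ⟨i - 1, _⟩`, so that the first block
consists of the indices `i` with `(i : ℕ) < m`. -/
structure IsCyclops {n : ℕ} (m : ℕ) (a : Fin n → ℝ) (b₁ b₂ : ℝ)
    (C : Matrix (Fin n) (Fin n) ℝ) : Prop where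
  eye_le : m ≤ n
  block₁₁ : ∀ i j : Fin n, (i : ℕ) < m → (j : ℕ) < m → C i j = a (max i j)
  block₁₂ : ∀ i j : Fin n, (i : ℕ) < m → m ≤ (j : ℕ) → C i j = b₁
  block₂₁ : ∀ i j : Fin n, m ≤ (i : ℕ) → (j : ℕ) < m → C i j = b₂
  block₂₂ : ∀ i j : Fin n, m ≤ (i : ℕ) → m ≤ (j : ℕ) → C i j = a (min i j)
  param₁ : ∀ i j : Fin n, i < j → (j : ℕ) < m → a j < a i
  param₂ : ∀ i j : Fin n, i < j → m ≤ (i : ℕ) → a i < a j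

/-- The set of differences `k - j` of indices `j ≤ m < k` (counted from one) for which
`a_j a_k - b₁ b₂` is negative. -/
def negGaps {n : ℕ} (m : ℕ) (a : Fin n → ℝ) (b₁ b₂ : ℝ) : Set ℕ :=
  {d | ∃ j k : Fin n, (j : ℕ) < m ∧ m ≤ (k : ℕ) ∧ a j * a k - b₁ * b₂ < 0 ∧ d = (k : ℕ) - (j : ℕ)}

/-- The set of differences `k - j` of indices `j ≤ m < k` (counted from one) for which
`a_j a_k - b₁ b₂` is positive. -/
def posGaps {n : ℕ} (m : ℕ) (a : Fin n → ℝ) (b₁ b₂ : ℝ) : Set ℕ :=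
  {d | ∃ j k : Fin n, (j : ℕ) < m ∧ m ≤ (k : ℕ) ∧ 0 < a j * a k - b₁ * b₂ ∧ d = (k : ℕ) - (j : ℕ)}

open Classical in
/-- The minimum of a set of natural numbers if it is nonempty, and `n + 1` otherwise. -/
def minOr (n : ℕ) (X : Set ℕ) : ℕ :=
  if X.Nonempty then sInf X else n + 1

open Classical in
/-- The number of positive parameters of the first block. -/
def numPosFirst {n : ℕ} (m : ℕ) (a : Fin n → ℝ) : ℕ :=
  (Finset.univ.filter (fun j : Fin n => (j : ℕ) < m ∧ 0 < a j)).card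

open Classical in
/-- The number of positive parameters of the second block. -/
def numPosSecond {n : ℕ} (m : ℕ) (a : Fin n → ℝ) : ℕ :=
  (Finset.univ.filter (fun j : Fin n => m ≤ (j : ℕ) ∧ 0 < a j)).card

end

/-!
The class `L_s` of a Z-matrix `A = tI - B` is read off from the signs of its principal minors: `A`
belongs to `L_s` when all principal minors of order at most `s` are nonnegative and some principal
minor of order `s + 1` is negative (`IsZMatrix.inClassL`). If all principal minors of a submatrix
are nonnegative, the expansion of the characteristic polynomial in principal minors shows that
`λI - B` has positive determinant for every `λ > t`; a Perron–Frobenius argument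
(`exists_pos_mulVec_le`) then produces positive vectors `x` with `Bx ≤ λx`, which bound the
spectral radius by `t`. Conversely, a negative principal minor forces a real eigenvalue of `B`
beyond `t`.

By Jacobi's identity (`principalMinor_inv_mul_det`) the principal minors of `C⁻¹` are, up to the
factor `det C`, the complementary principal minors of `C`. So `C⁻¹` belongs to `L_s` with
`s = n - 1 - N`, where `N` is the largest order of a principal minor of `C` whose sign is opposite
to that of `det C` (`inClassL_inv_of_principalMinor`).

The principal minor of a cyclops on an index set `S` is a positive multiple of `1`, of `a_j`, of
`a_k` or of `a_j a_k - b₁ b₂`, where `j` is the last index of `S` in the first block and `k` the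
first index of `S` in the second block, as far as these exist (`IsCyclops.principalMinor_cases`).
Finding `N` is then a count. The only further information used is that `b₁ b₂ ≥ 0`, because `-b₁`
and `-b₂` are multiples, by the same factor `a_m a_{m+1} - b₁ b₂`, of sums of off-diagonal entries
of `C⁻¹` (`IsCyclops.mul_nonneg_of_isZMatrix_inv`).
-/

open Matrix Finset

/-! ### Principal minors -/

/-- The principal minor of `A` with rows and columns indexed by `S`; the empty minor is `1`. -/
noncomputable def principalMinor {ι : Type*} [DecidableEq ι] (A : Matrix ι ι ℝ) (S : Finset ι) :
    ℝ :=
  (A.submatrix (↑) (↑) : Matrix S S ℝ).det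

section PrincipalMinor

variable {ι κ : Type*} [DecidableEq ι] [Fintype κ] [DecidableEq κ]

theorem principalMinor_congr {A A' : Matrix ι ι ℝ} {S : Finset ι}
    (h : ∀ i ∈ S, ∀ j ∈ S, A i j = A' i j) : principalMinor A S = principalMinor A' S := by
  unfold principalMinor
  congr 1
  ext i j
  exact h _ i.2 _ j.2

theorem principalMinor_image (A : Matrix ι ι ℝ) {f : κ → ι} (hf : Function.Injective f) :
    principalMinor A (univ.image f) = (A.submatrix f f).det := by
  let e : κ ≃ (univ.image f : Finset ι) :=
    Equiv.ofBijective (fun k => ⟨f k, by simp⟩) ⟨fun x y h => hf (by simpa using h), by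
      rintro ⟨y, hy⟩
      obtain ⟨x, -, rfl⟩ := Finset.mem_image.1 hy
      exact ⟨x, rfl⟩⟩
  rw [principalMinor, ← det_submatrix_equiv_self e]
  rfl

@[simp]
theorem principalMinor_empty (A : Matrix ι ι ℝ) : principalMinor A ∅ = 1 := by
  simp [principalMinor]

@[simp]
theorem principalMinor_singleton (A : Matrix ι ι ℝ) (i : ι) : principalMinor A {i} = A i i := by
  have h := principalMinor_image A (f := fun _ : Fin 1 => i) (fun x y _ => Subsingleton.elim x y)
  simpa using h

theorem principalMinor_pair (A : Matrix ι ι ℝ) {i j : ι} (hij : i ≠ j) :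
    principalMinor A {i, j} = A i i * A j j - A i j * A j i := by
  have hinj : Function.Injective ![i, j] := by
    intro x y h
    fin_cases x <;> fin_cases y <;> simp_all [eq_comm]
  have h := principalMinor_image A hinj
  have himg : univ.image ![i, j] = {i, j} := by
    ext x
    simp [eq_comm]
  rw [himg] at h
  rw [h, det_fin_two]
  simp

theorem principalMinor_univ [Fintype ι] (A : Matrix ι ι ℝ) : principalMinor A univ = A.det := by
  simpa using principalMinor_image A (f := (id : ι → ι)) Function.injective_id

/-- Filling up the rows outside `S` with rows of the identity matrix turns a principal minor into a
determinant of full size. -/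
theorem principalMinor_eq_det [Fintype ι] (A : Matrix ι ι ℝ) (S : Finset ι) :
    principalMinor A S = (of fun i => if i ∈ S then A i else (1 : Matrix ι ι ℝ) i).det :=
  (det_piecewise_one_eq_submatrix_det A S).symm

/-- Jacobi's identity for complementary principal minors of a matrix and its inverse. -/
theorem principalMinor_inv_mul_det [Fintype ι] (C : Matrix ι ι ℝ) (hC : C.det ≠ 0)
    (S : Finset ι) : principalMinor C⁻¹ S * C.det = principalMinor C Sᶜ := by
  rw [principalMinor_eq_det, principalMinor_eq_det, ← det_mul]
  congr 1
  have hinv : C⁻¹ * C = 1 := nonsing_inv_mul C (isUnit_iff_ne_zero.2 hC)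
  ext i j
  by_cases hi : i ∈ S
  · have : (C⁻¹ * C) i j = (1 : Matrix ι ι ℝ) i j := by rw [hinv]
    simpa [mul_apply, hi] using this
  · have : ((1 : Matrix ι ι ℝ) * C) i j = C i j := by rw [Matrix.one_mul]
    simpa only [mul_apply, of_apply, hi, if_false, mem_compl, not_false_eq_true, if_true] using this

/-- If rows `i` and `i'` agree on `S` outside column `i`, subtracting row `i'` from row `i` splits
off the factor `A i i - A i' i`. -/
theorem principalMinor_eq_mul_erase [Fintype ι] (A : Matrix ι ι ℝ) {S : Finset ι} {i i' : ι}
    (hi : i ∈ S) (hi' : i' ∈ S) (hne : i ≠ i') (h : ∀ l ∈ S, l ≠ i → A i l = A i' l) :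
    principalMinor A S = (A i i - A i' i) * principalMinor A (S.erase i) := by
  -- Only the entries with column in `S` matter, so the others are first set to zero.
  set A' : Matrix ι ι ℝ := of fun k l => if l ∈ S then A k l else 0 with hA'
  have h1 : principalMinor A S = principalMinor A' S :=
    principalMinor_congr fun k _ l hl => by simp [hA', hl]
  have h2 : principalMinor A (S.erase i) = principalMinor A' (S.erase i) :=
    principalMinor_congr fun k _ l hl => by simp [hA', Finset.mem_of_mem_erase hl]
  rw [h1, h2, principalMinor_eq_det, principalMinor_eq_det]
  set D : Matrix ι ι ℝ := of fun k => if k ∈ S then A' k else (1 : Matrix ι ι ℝ) k with hD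
  have hrow : D.updateRow i (D i + (-1 : ℝ) • D i') =
      (of fun k => if k ∈ S.erase i then A' k else (1 : Matrix ι ι ℝ) k).updateRow i
        ((A i i - A i' i) • (1 : Matrix ι ι ℝ) i) := by
    ext k l
    by_cases hk : k = i
    · subst hk
      simp only [updateRow_self, Pi.add_apply, Pi.smul_apply, smul_eq_mul, hD, of_apply, hi, hi',
        if_true, hA']
      by_cases hl : l = k
      · subst hl
        simp [hi]
        ring
      · rw [one_apply_ne (Ne.symm hl)]
        by_cases hlS : l ∈ S
        · simp [hlS, h l hlS hl]
        · simp [hlS]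
    · simp [hD, hk]
  rw [← det_updateRow_add_smul_self D hne (-1), hrow, det_updateRow_smul]
  congr 2
  ext k l
  by_cases hk : k = i
  · subst hk
    simp
  · simp [updateRow_ne hk]

theorem det_smul_one_sub {R : Type*} [CommRing R] (M : Matrix κ κ R) (μ : R) :
    (μ • (1 : Matrix κ κ R) - M).det = M.charpoly.eval μ := by
  rw [eval_charpoly, smul_one_eq_diagonal, scalar_apply]

/-- By the expansion of the characteristic polynomial of `-A` in principal minors, `det (uI + A)` is
a monic polynomial in `u` with nonnegative coefficients. -/
theorem det_smul_one_add_pos (A : Matrix κ κ ℝ) (hA : ∀ S, 0 ≤ principalMinor A S) {u : ℝ}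
    (hu : 0 < u) : 0 < (u • (1 : Matrix κ κ ℝ) + A).det := by
  have hcoeff : ∀ k, 0 ≤ (-A).charpoly.coeff k := by
    intro k
    rcases le_or_gt k (Fintype.card κ) with hk | hk
    · have h := charpoly_coeff_eq_sum_minors (-A) (Fintype.card κ - k) (Nat.sub_le _ _)
      rw [Nat.sub_sub_self hk] at h
      rw [h, mul_sum]
      refine sum_nonneg fun S hS => ?_
      have hneg : ((-A).submatrix (Subtype.val : S → κ) (Subtype.val : S → κ)).det =
          (-1) ^ (Fintype.card κ - k) * principalMinor A S := by
        simp only [submatrix_neg, Pi.neg_apply]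
        rw [det_neg, Fintype.card_coe, (mem_powersetCard.1 hS).2]
        rfl
      rw [hneg, ← mul_assoc, ← mul_pow]
      simpa using hA S
    · rw [Polynomial.coeff_eq_zero_of_natDegree_lt]
      rwa [charpoly_natDegree_eq_dim]
  have heval : (u • (1 : Matrix κ κ ℝ) + A).det = (-A).charpoly.eval u := by
    rw [← det_smul_one_sub, sub_neg_eq_add]
  rw [heval, Polynomial.eval_eq_sum_range]
  refine sum_pos' (fun k _ => mul_nonneg (hcoeff k) (pow_nonneg hu.le k))
    ⟨(-A).charpoly.natDegree, by simp, ?_⟩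
  rw [Polynomial.coeff_natDegree, (charpoly_monic _).leadingCoeff]
  positivity

end PrincipalMinor

/-! ### Spectral radii of nonnegative matrices -/

section SpectralRadius

variable {κ : Type*} [Fintype κ] [DecidableEq κ]

theorem mem_spectrum_map_ofReal_iff (M : Matrix κ κ ℝ) (z : ℂ) :
    z ∈ spectrum ℂ (M.map (fun r : ℝ => (r : ℂ))) ↔
      (z • (1 : Matrix κ κ ℂ) - M.map (fun r : ℝ => (r : ℂ))).det = 0 := by
  rw [mem_spectrum_iff_isRoot_charpoly, Polynomial.IsRoot.def, det_smul_one_sub]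

/-- The easy half of the Collatz–Wielandt bound: a positive vector `x` with `Mx ≤ μx` bounds all
eigenvalues, by comparing an eigenvector with `x` at a coordinate where their quotient is maximal. -/
theorem norm_le_of_mulVec_le (M : Matrix κ κ ℝ) (hM : ∀ i j, 0 ≤ M i j) {μ : ℝ} {x : κ → ℝ}
    (hx : ∀ i, 0 < x i) (hMx : ∀ i, (M *ᵥ x) i ≤ μ * x i) {z : ℂ}
    (hz : z ∈ spectrum ℂ (M.map (fun r : ℝ => (r : ℂ)))) : ‖z‖ ≤ μ := by
  obtain ⟨v, hv, hzv⟩ := exists_mulVec_eq_zero_iff.2 ((mem_spectrum_map_ofReal_iff M z).1 hz)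
  obtain ⟨i₀, hi₀⟩ := Function.ne_iff.1 hv
  obtain ⟨i, -, hi⟩ := exists_max_image univ (fun i => ‖v i‖ / x i) ⟨i₀, mem_univ _⟩
  set c := ‖v i‖ / x i with hc
  have hle : ∀ j, ‖v j‖ ≤ c * x j := fun j => (div_le_iff₀ (hx j)).1 (hi j (mem_univ j))
  have hvi : ‖v i‖ = c * x i := by rw [hc, div_mul_cancel₀ _ (hx i).ne']
  have hcpos : 0 < c := lt_of_lt_of_le (div_pos (norm_pos_iff.2 hi₀) (hx i₀)) (hi i₀ (mem_univ _))
  have heq : z * v i = ∑ j, (M i j : ℂ) * v j := by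
    have h := congrFun hzv i
    rw [sub_mulVec, smul_mulVec, one_mulVec] at h
    simpa [mulVec, dotProduct, sub_eq_zero] using h
  have key : ‖z‖ * (c * x i) ≤ μ * (c * x i) := calc
    ‖z‖ * (c * x i) = ‖∑ j, (M i j : ℂ) * v j‖ := by rw [← heq, norm_mul, hvi]
    _ ≤ ∑ j, M i j * (c * x j) := by
      refine (norm_sum_le _ _).trans (sum_le_sum fun j _ => ?_)
      rw [norm_mul, Complex.norm_real, Real.norm_of_nonneg (hM i j)]
      exact mul_le_mul_of_nonneg_left (hle j) (hM i j)
    _ = c * (M *ᵥ x) i := by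
      simp only [mulVec, dotProduct, mul_sum]
      exact sum_congr rfl fun j _ => by ring
    _ ≤ c * (μ * x i) := mul_le_mul_of_nonneg_left (hMx i) hcpos.le
    _ = μ * (c * x i) := by ring
  exact le_of_mul_le_mul_right key (mul_pos hcpos (hx i))

/-- If `det (μI - M) > 0` for all `μ > t ≥ 0`, then the vectors `adj (μI - M) 𝟙` are positive for
all `μ > t`: they are positive for large `μ`, and since
`μ adj (μI - M) 𝟙 = det (μI - M) 𝟙 + M adj (μI - M) 𝟙`, no coordinate can vanish as long as all
are nonnegative. -/
theorem exists_pos_mulVec_le (M : Matrix κ κ ℝ) (hM : ∀ i j, 0 ≤ M i j) {t : ℝ} (ht : 0 ≤ t)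
    (hdet : ∀ μ, t < μ → 0 < (μ • (1 : Matrix κ κ ℝ) - M).det) {μ : ℝ} (hμ : t < μ) :
    ∃ x : κ → ℝ, (∀ i, 0 < x i) ∧ ∀ i, (M *ᵥ x) i ≤ μ * x i := by
  set y : ℝ → κ → ℝ := fun μ => (μ • (1 : Matrix κ κ ℝ) - M).adjugate *ᵥ 1 with hy
  have hycont : ∀ i, Continuous fun μ => y μ i := by
    intro i
    have hA : Continuous fun μ : ℝ => μ • (1 : Matrix κ κ ℝ) - M := by fun_prop
    have : Continuous y := (hA.matrix_adjugate).matrix_mulVec continuous_const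
    exact (continuous_apply i).comp this
  have hyeq : ∀ μ i, μ * y μ i = (μ • (1 : Matrix κ κ ℝ) - M).det + (M *ᵥ y μ) i := by
    intro μ i
    have h : (μ • (1 : Matrix κ κ ℝ) - M) *ᵥ y μ =
        (μ • (1 : Matrix κ κ ℝ) - M).det • (1 : κ → ℝ) := by
      rw [hy, mulVec_mulVec, mul_adjugate, smul_mulVec, one_mulVec]
    have h' := congrFun h i
    rw [sub_mulVec, smul_mulVec, one_mulVec] at h'
    simp only [Pi.sub_apply, Pi.smul_apply, smul_eq_mul, Pi.one_apply, mul_one] at h'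
    linarith
  have hpos : Set.Ioi t ⊆ {μ | t < μ ∧ ∀ i, 0 < y μ i} := by
    refine isPreconnected_Ioi.subset_of_closure_inter_subset ?_ ?_ ?_
    · have : {μ | t < μ ∧ ∀ i, 0 < y μ i} = Set.Ioi t ∩ ⋂ i, {μ | 0 < y μ i} := by
        ext; simp
      rw [this]
      exact isOpen_Ioi.inter
        (isOpen_iInter_of_finite fun i => isOpen_lt continuous_const (hycont i))
    · -- for `μ` above all row sums of `M`, consider the least coordinate of the vector
      have hsum : 0 ≤ ∑ i, ∑ j, M i j := sum_nonneg fun i _ => sum_nonneg fun j _ => hM i j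
      set μ₀ := t + 1 + ∑ i, ∑ j, M i j with hμ₀
      have hlt : t < μ₀ := by linarith
      refine ⟨μ₀, hlt, hlt, fun k => ?_⟩
      obtain ⟨i, -, hi⟩ := exists_min_image univ (y μ₀) ⟨k, mem_univ _⟩
      refine lt_of_lt_of_le ?_ (hi k (mem_univ k))
      have hrow : ∑ j, M i j ≤ ∑ i, ∑ j, M i j :=
        single_le_sum (f := fun i => ∑ j, M i j) (fun i _ => sum_nonneg fun j _ => hM i j)
          (mem_univ i)
      have hge : (∑ j, M i j) * y μ₀ i ≤ (M *ᵥ y μ₀) i := by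
        rw [sum_mul]
        exact sum_le_sum fun j _ => mul_le_mul_of_nonneg_left (hi j (mem_univ j)) (hM i j)
      have h : 0 < (μ₀ - ∑ j, M i j) * y μ₀ i := by
        have h1 := hyeq μ₀ i
        have h2 := hdet μ₀ hlt
        rw [sub_mul]
        linarith
      exact pos_of_mul_pos_right h (by linarith)
    · rintro μ ⟨hcl, hμ⟩
      have hnn : ∀ i, 0 ≤ y μ i := by
        intro i
        have hsub : {μ | t < μ ∧ ∀ i, 0 < y μ i} ⊆ {μ | 0 ≤ y μ i} := fun μ h => (h.2 i).le
        exact closure_minimal hsub (isClosed_le continuous_const (hycont i)) hcl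
      refine ⟨hμ, fun i => ?_⟩
      have hMy : 0 ≤ (M *ᵥ y μ) i := sum_nonneg fun j _ => mul_nonneg (hM i j) (hnn j)
      have h : 0 < μ * y μ i := by
        have := hdet μ hμ
        rw [hyeq]
        linarith
      exact pos_of_mul_pos_right h (ht.trans (le_of_lt hμ))
  refine ⟨y μ, (hpos hμ).2, fun i => ?_⟩
  have := hdet μ hμ
  rw [hyeq]
  linarith

theorem spectralRadius_le_ofReal_of_det_pos (M : Matrix κ κ ℝ) (hM : ∀ i j, 0 ≤ M i j) {t : ℝ}
    (ht : 0 ≤ t) (hdet : ∀ μ, t < μ → 0 < (μ • (1 : Matrix κ κ ℝ) - M).det) :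
    spectralRadius ℂ (M.map (fun r : ℝ => (r : ℂ))) ≤ ENNReal.ofReal t := by
  refine iSup₂_le fun z hz => ?_
  have h : ‖z‖ ≤ t := le_of_forall_gt_imp_ge_of_dense fun μ hμ => by
    obtain ⟨x, hx, hMx⟩ := exists_pos_mulVec_le M hM ht hdet hμ
    exact norm_le_of_mulVec_le M hM hx hMx hz
  rw [← enorm_eq_nnnorm, ← ofReal_norm]
  exact ENNReal.ofReal_le_ofReal h

/-- A negative value of the characteristic polynomial at `t` forces a real eigenvalue beyond
`t`. -/
theorem ofReal_lt_spectralRadius_of_det_neg (M : Matrix κ κ ℝ) {t : ℝ} (ht : 0 ≤ t)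
    (hdet : (t • (1 : Matrix κ κ ℝ) - M).det < 0) :
    ENNReal.ofReal t < spectralRadius ℂ (M.map (fun r : ℝ => (r : ℂ))) := by
  have hne : Nonempty κ := by
    by_contra h
    rw [not_nonempty_iff] at h
    rw [det_isEmpty] at hdet
    exact absurd hdet (not_lt.2 zero_le_one)
  rw [det_smul_one_sub] at hdet
  have hlim : Filter.Tendsto (fun μ => M.charpoly.eval μ) Filter.atTop Filter.atTop := by
    refine Polynomial.tendsto_atTop_of_leadingCoeff_nonneg _ ?_ ?_
    · rw [charpoly_degree_eq_dim]
      exact_mod_cast Fintype.card_pos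
    · rw [(charpoly_monic M).leadingCoeff]
      exact zero_le_one
  obtain ⟨T, hT0, htT⟩ :=
    ((hlim.eventually_ge_atTop 0).and (Filter.eventually_ge_atTop t)).exists
  obtain ⟨μ, hμ, hμ0⟩ := intermediate_value_Icc htT
    (f := fun μ => M.charpoly.eval μ) (Polynomial.continuous _).continuousOn ⟨hdet.le, hT0⟩
  have htμ : t < μ := lt_of_le_of_ne hμ.1 (by rintro rfl; exact hdet.ne hμ0)
  have hmem : (μ : ℂ) ∈ spectrum ℂ (M.map (fun r : ℝ => (r : ℂ))) := by
    rw [mem_spectrum_map_ofReal_iff]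
    have hmap : ((μ : ℂ) • (1 : Matrix κ κ ℂ) - M.map (fun r : ℝ => (r : ℂ))) =
        Complex.ofRealHom.mapMatrix (μ • (1 : Matrix κ κ ℝ) - M) := by
      ext i j
      simp [one_apply, apply_ite]
    rw [hmap, ← RingHom.map_det, det_smul_one_sub]
    simpa using hμ0
  refine lt_of_lt_of_le ?_ (le_iSup₂ (f := fun z _ => (‖z‖₊ : ℝ≥0∞)) (μ : ℂ) hmem)
  rw [← enorm_eq_nnnorm, ← ofReal_norm, Complex.norm_real, Real.norm_of_nonneg (ht.trans htμ.le)]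
  exact (ENNReal.ofReal_lt_ofReal_iff (ht.trans_lt htμ)).2 htμ

end SpectralRadius

/-! ### The classes `L_s` in terms of principal minors -/

section ClassL

variable {n : ℕ} {A B : Matrix (Fin n) (Fin n) ℝ} {S : Finset (Fin n)} {s : ℕ} {t : ℝ}

theorem principalSpectralRadius_le (hB : ∀ i j, 0 ≤ B i j) (ht : 0 ≤ t)
    (h : ∀ T ⊆ S, 0 ≤ principalMinor (t • (1 : Matrix (Fin n) (Fin n) ℝ) - B) T) :
    principalSpectralRadius B S ≤ ENNReal.ofReal t := by
  refine spectralRadius_le_ofReal_of_det_pos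
    (B.submatrix (fun i : S => (i : Fin n)) fun j : S => (j : Fin n)) (fun i j => hB _ _) ht fun μ hμ => ?_
  set A := t • (1 : Matrix (Fin n) (Fin n) ℝ) - B with hA
  have hsub : (μ • (1 : Matrix S S ℝ) - B.submatrix (fun i : S => (i : Fin n)) fun j : S => (j : Fin n))
      = (μ - t) • (1 : Matrix S S ℝ) + A.submatrix (fun i : S => (i : Fin n))
        fun j : S => (j : Fin n) := by
    ext i j
    simp only [hA, Matrix.sub_apply, Matrix.add_apply, Matrix.smul_apply, submatrix_apply,
      one_apply, Subtype.ext_iff, smul_eq_mul]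
    ring
  rw [hsub]
  refine det_smul_one_add_pos _ (fun T => ?_) (sub_pos.2 hμ)
  have himg := principalMinor_image A (f := fun x : T => ((x : S) : Fin n))
    (Subtype.val_injective.comp Subtype.val_injective)
  have heq : principalMinor (A.submatrix (fun i : S => (i : Fin n)) fun j : S => (j : Fin n)) T =
      principalMinor A (univ.image fun x : T => ((x : S) : Fin n)) := himg.symm
  rw [heq]
  refine h _ fun x hx => ?_
  obtain ⟨y, -, rfl⟩ := mem_image.1 hx
  exact y.1.2

theorem ofReal_lt_principalSpectralRadius (ht : 0 ≤ t)
    (h : principalMinor (t • (1 : Matrix (Fin n) (Fin n) ℝ) - B) S < 0) :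
    ENNReal.ofReal t < principalSpectralRadius B S := by
  refine ofReal_lt_spectralRadius_of_det_neg _ ht ?_
  convert h using 1
  unfold principalMinor
  congr 1
  ext i j
  simp only [Matrix.sub_apply, Matrix.smul_apply, submatrix_apply, one_apply,
    Subtype.ext_iff]

/-- The shift `t` is taken as the sum of the absolute values of the diagonal entries. -/
theorem IsZMatrix.exists_eq_smul_one_sub (hA : IsZMatrix A) :
    ∃ (t : ℝ) (B : Matrix (Fin n) (Fin n) ℝ), 0 ≤ t ∧ (∀ i j, 0 ≤ B i j) ∧
      A = t • (1 : Matrix (Fin n) (Fin n) ℝ) - B := by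
  refine ⟨∑ i, |A i i|, (∑ i, |A i i|) • (1 : Matrix (Fin n) (Fin n) ℝ) - A,
    sum_nonneg fun i _ => abs_nonneg _, fun i j => ?_, by simp⟩
  by_cases hij : i = j
  · subst hij
    have h : |A i i| ≤ ∑ i, |A i i| :=
      single_le_sum (f := fun i => |A i i|) (fun i _ => abs_nonneg _) (mem_univ i)
    simpa using (le_abs_self _).trans h
  · simpa [one_apply_ne hij] using hA i j hij

theorem coe_ofReal_eq (ht : 0 ≤ t) : ((ENNReal.ofReal t : ℝ≥0∞) : EReal) = (t : EReal) := by
  rw [EReal.coe_ennreal_ofReal, max_eq_left ht]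

/-- A Z-matrix whose principal minors of order at most `s` are nonnegative belongs to `L_s` as soon
as it has a negative principal minor of order `s + 1`. -/
theorem IsZMatrix.inClassL (hA : IsZMatrix A) (hs : s ≤ n)
    (hnonneg : ∀ S : Finset (Fin n), S.card ≤ s → 0 ≤ principalMinor A S)
    (hneg : s < n → ∃ S : Finset (Fin n), S.card = s + 1 ∧ principalMinor A S < 0) :
    InClassL s A := by
  obtain ⟨t, B, ht, hB, rfl⟩ := hA.exists_eq_smul_one_sub
  refine ⟨hs, t, B, hB, rfl, ?_, ?_⟩
  · unfold rhoSub
    split_ifs with h0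
    · exact bot_le
    · omega
    · refine iSup_le fun S => ?_
      rw [← coe_ofReal_eq ht, EReal.coe_ennreal_le_coe_ennreal_iff]
      exact principalSpectralRadius_le hB ht fun T hT => hnonneg T ((card_le_card hT).trans S.2.le)
  · rw [rhoSub, if_neg s.succ_ne_zero]
    split_ifs with h1
    · exact EReal.coe_lt_top t
    · obtain ⟨S, hcard, hS⟩ := hneg (by omega)
      refine lt_of_lt_of_le ?_ (le_iSup (fun S : {S : Finset (Fin n) // S.card = s + 1} =>
        ((principalSpectralRadius B S.1 : ℝ≥0∞) : EReal)) ⟨S, hcard⟩)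
      rw [← coe_ofReal_eq ht, EReal.coe_ennreal_lt_coe_ennreal_iff]
      exact ofReal_lt_principalSpectralRadius ht hS

theorem IsZMatrix.isMMatrix (hA : IsZMatrix A)
    (hnonneg : ∀ S : Finset (Fin n), 0 ≤ principalMinor A S) : IsMMatrix A := by
  obtain ⟨t, B, ht, hB, rfl⟩ := hA.exists_eq_smul_one_sub
  refine ⟨t, B, hB, rfl, ?_⟩
  rw [← coe_ofReal_eq ht, EReal.coe_ennreal_le_coe_ennreal_iff]
  exact principalSpectralRadius_le hB ht fun T _ => hnonneg T

/-- If `C⁻¹` is a Z-matrix and `N` is the largest order of a principal minor of `C` whose sign is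
opposite to that of `det C`, then `C⁻¹` belongs to `L_s` with `s = n - 1 - N`. -/
theorem inClassL_inv_of_principalMinor {C : Matrix (Fin n) (Fin n) ℝ} (hdet : C.det ≠ 0)
    (hZ : IsZMatrix C⁻¹) {N : ℕ}
    (hle : ∀ S : Finset (Fin n), principalMinor C S * C.det < 0 → S.card ≤ N)
    (hex : ∃ S : Finset (Fin n), S.card = N ∧ principalMinor C S * C.det < 0) :
    N < n ∧ InClassL (n - 1 - N) C⁻¹ := by
  obtain ⟨S, hS, hSneg⟩ := hex
  have hsq : 0 < C.det * C.det := mul_self_pos.2 hdet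
  have hinv : ∀ T, principalMinor C⁻¹ T * (C.det * C.det) = principalMinor C Tᶜ * C.det := fun T => by
    rw [← mul_assoc, principalMinor_inv_mul_det C hdet]
  have hSn : S.card ≤ n := by simpa using card_le_univ S
  have hNn : N < n := by
    refine lt_of_le_of_ne (hS ▸ hSn) fun h => ?_
    have : S = univ := by rw [← card_eq_iff_eq_univ, hS, h, Fintype.card_fin]
    rw [this, principalMinor_univ] at hSneg
    exact absurd hSneg (not_lt.2 hsq.le)
  refine ⟨hNn, hZ.inClassL (by omega) (fun T hT => ?_) fun _ => ⟨Sᶜ, ?_, ?_⟩⟩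
  · by_contra hneg
    have h := hle Tᶜ (by
      rw [← hinv]
      exact mul_neg_of_neg_of_pos (not_le.1 hneg) hsq)
    rw [card_compl, Fintype.card_fin] at h
    omega
  · rw [card_compl, Fintype.card_fin, hS]
    omega
  · refine neg_of_mul_neg_left (b := C.det * C.det) ?_ hsq.le
    rw [hinv, compl_compl]
    exact hSneg

theorem principalMinor_inv_nonneg {C : Matrix (Fin n) (Fin n) ℝ} (hdet : 0 < C.det)
    (h : ∀ S, 0 ≤ principalMinor C S) (S : Finset (Fin n)) : 0 ≤ principalMinor C⁻¹ S := by
  refine nonneg_of_mul_nonneg_left ?_ hdet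
  rw [principalMinor_inv_mul_det C hdet.ne']
  exact h Sᶜ

end ClassL

/-! ### Principal minors of a cyclops -/

namespace IsCyclops

variable {n m : ℕ} {a : Fin n → ℝ} {b₁ b₂ : ℝ} {C : Matrix (Fin n) (Fin n) ℝ}
  {S : Finset (Fin n)}

theorem antitone_first (hC : IsCyclops m a b₁ b₂ C) {i j : Fin n} (hij : i ≤ j)
    (hj : (j : ℕ) < m) : a j ≤ a i := by
  rcases hij.eq_or_lt with rfl | h
  · exact le_rfl
  · exact (hC.param₁ i j h hj).le

theorem monotone_second (hC : IsCyclops m a b₁ b₂ C) {i j : Fin n} (hij : i ≤ j)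
    (hi : m ≤ (i : ℕ)) : a i ≤ a j := by
  rcases hij.eq_or_lt with rfl | h
  · exact le_rfl
  · exact (hC.param₂ i j h hi).le

/-- Indices of the first block other than the last one in `S`, and indices of the second block other
than the first one in `S`, only contribute positive factors to a principal minor. They are removed
one at a time, starting at the outer ends of `S`, by subtracting the adjacent row. -/
theorem exists_principalMinor_eq_mul (hC : IsCyclops m a b₁ b₂ C) {S' : Finset (Fin n)}
    (S : Finset (Fin n)) (hsub : S' ⊆ S)
    (h₁ : ∀ l ∈ S, (l : ℕ) < m → ∃ j ∈ S', (j : ℕ) < m)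
    (h₁' : ∀ j ∈ S', (j : ℕ) < m → ∀ l ∈ S, (l : ℕ) < m → l ≤ j)
    (h₂ : ∀ l ∈ S, m ≤ (l : ℕ) → ∃ k ∈ S', m ≤ (k : ℕ))
    (h₂' : ∀ k ∈ S', m ≤ (k : ℕ) → ∀ l ∈ S, m ≤ (l : ℕ) → k ≤ l) :
    ∃ c, 0 < c ∧ principalMinor C S = c * principalMinor C S' := by
  induction S using Finset.strongInduction with
  | H S ih =>
  -- the induction step, once the row `i` to be removed and an adjacent row `i'` are found
  have step : ∀ i i' : Fin n, i ∈ S → i ∉ S' → i' ∈ S → i ≠ i' →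
      (∀ l ∈ S, l ≠ i → C i l = C i' l) → C i' i < C i i →
      ∃ c, 0 < c ∧ principalMinor C S = c * principalMinor C S' := by
    intro i i' hi hiS' hi' hne heq hlt
    obtain ⟨c, hc, hcS⟩ := ih (S.erase i) (erase_ssubset hi)
      (fun x hx => mem_erase.2 ⟨fun h => hiS' (h ▸ hx), hsub hx⟩)
      (fun l hl => h₁ l (mem_of_mem_erase hl))
      (fun j hj hjm l hl => h₁' j hj hjm l (mem_of_mem_erase hl))
      (fun l hl => h₂ l (mem_of_mem_erase hl))
      (fun j hj hjm l hl => h₂' j hj hjm l (mem_of_mem_erase hl))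
    refine ⟨(C i i - C i' i) * c, mul_pos (sub_pos.2 hlt) hc, ?_⟩
    rw [principalMinor_eq_mul_erase C hi hi' hne heq, hcS, mul_assoc]
  by_cases hSS' : S ⊆ S'
  · exact ⟨1, one_pos, by rw [one_mul, subset_antisymm hSS' hsub]⟩
  obtain ⟨l, hlS, hlS'⟩ := not_subset.1 hSS'
  rcases lt_or_ge (l : ℕ) m with hlm | hlm
  · obtain ⟨j, hj, hjm⟩ := h₁ l hlS hlm
    have hlj : l < j := lt_of_le_of_ne (h₁' j hj hjm l hlS hlm) fun h => hlS' (h ▸ hj)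
    have hne : S.Nonempty := ⟨l, hlS⟩
    set i := S.min' hne
    have hil : i ≤ l := min'_le _ _ hlS
    have hij : i < j := hil.trans_lt hlj
    have hne' : (S.erase i).Nonempty := ⟨j, mem_erase.2 ⟨hij.ne', hsub hj⟩⟩
    set i' := (S.erase i).min' hne'
    have hi'S := min'_mem _ hne'
    have hi'j : i' ≤ j := min'_le _ _ (mem_erase.2 ⟨hij.ne', hsub hj⟩)
    have hii' : i < i' := lt_of_le_of_ne (min'_le _ _ (mem_of_mem_erase hi'S))
      (ne_of_mem_erase hi'S).symm
    have him : (i : ℕ) < m := lt_of_le_of_lt hil hlm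
    have hi'm : (i' : ℕ) < m := lt_of_le_of_lt hi'j hjm
    refine step i i' (min'_mem _ _) (fun h => ?_) (mem_of_mem_erase hi'S) hii'.ne
      (fun x hx hxi => ?_) ?_
    · exact absurd (h₁' i h him j (hsub hj) hjm) (not_le.2 hij)
    · have hi'x : i' ≤ x := min'_le _ _ (mem_erase.2 ⟨hxi, hx⟩)
      rcases lt_or_ge (x : ℕ) m with hxm | hxm
      · rw [hC.block₁₁ _ _ him hxm, hC.block₁₁ _ _ hi'm hxm, max_eq_right hi'x,
          max_eq_right (hii'.le.trans hi'x)]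
      · rw [hC.block₁₂ _ _ him hxm, hC.block₁₂ _ _ hi'm hxm]
    · rw [hC.block₁₁ _ _ him him, hC.block₁₁ _ _ hi'm him, max_self, max_eq_left hii'.le]
      exact hC.param₁ _ _ hii' hi'm
  · obtain ⟨k, hk, hkm⟩ := h₂ l hlS hlm
    have hkl : k < l := lt_of_le_of_ne (h₂' k hk hkm l hlS hlm) fun h => hlS' (h ▸ hk)
    have hne : S.Nonempty := ⟨l, hlS⟩
    set i := S.max' hne
    have hli : l ≤ i := le_max' _ _ hlS
    have hki : k < i := hkl.trans_le hli
    have hne' : (S.erase i).Nonempty := ⟨k, mem_erase.2 ⟨hki.ne, hsub hk⟩⟩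
    set i' := (S.erase i).max' hne'
    have hi'S := max'_mem _ hne'
    have hki' : k ≤ i' := le_max' _ _ (mem_erase.2 ⟨hki.ne, hsub hk⟩)
    have hi'i : i' < i := lt_of_le_of_ne (le_max' _ _ (mem_of_mem_erase hi'S))
      (ne_of_mem_erase hi'S)
    have him : m ≤ (i : ℕ) := le_trans hlm hli
    have hi'm : m ≤ (i' : ℕ) := le_trans hkm hki'
    refine step i i' (max'_mem _ _) (fun h => ?_) (mem_of_mem_erase hi'S) hi'i.ne'
      (fun x hx hxi => ?_) ?_
    · exact absurd (h₂' i h him k (hsub hk) hkm) (not_le.2 hki)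
    · have hxi' : x ≤ i' := le_max' _ _ (mem_erase.2 ⟨hxi, hx⟩)
      rcases lt_or_ge (x : ℕ) m with hxm | hxm
      · rw [hC.block₂₁ _ _ him hxm, hC.block₂₁ _ _ hi'm hxm]
      · rw [hC.block₂₂ _ _ him hxm, hC.block₂₂ _ _ hi'm hxm, min_eq_right hxi',
          min_eq_right (hxi'.trans hi'i.le)]
    · rw [hC.block₂₂ _ _ him him, hC.block₂₂ _ _ hi'm him, min_self, min_eq_left hi'i.le]
      exact hC.param₂ _ _ hi'i hi'm

theorem principalMinor_first (hC : IsCyclops m a b₁ b₂ C) {j : Fin n} (hj : j ∈ S)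
    (hjm : (j : ℕ) < m) (hS : ∀ l ∈ S, l ≤ j) :
    ∃ c, 0 < c ∧ principalMinor C S = c * a j := by
  have hlt : ∀ l ∈ S, (l : ℕ) < m := fun l hl => lt_of_le_of_lt (hS l hl) hjm
  have h := hC.exists_principalMinor_eq_mul (S' := {j}) S (by simpa using hj)
    (fun _ _ _ => ⟨j, by simp, hjm⟩) (fun i hi _ l hl _ => by
      rw [mem_singleton.1 hi]
      exact hS l hl)
    (fun l hl h => absurd (hlt l hl) (not_lt.2 h))
    (fun _ _ _ l hl h => absurd (hlt l hl) (not_lt.2 h))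
  rwa [principalMinor_singleton, hC.block₁₁ j j hjm hjm, max_self] at h

theorem principalMinor_second (hC : IsCyclops m a b₁ b₂ C) {k : Fin n} (hk : k ∈ S)
    (hkm : m ≤ (k : ℕ)) (hS : ∀ l ∈ S, k ≤ l) :
    ∃ c, 0 < c ∧ principalMinor C S = c * a k := by
  have hge : ∀ l ∈ S, m ≤ (l : ℕ) := fun l hl => le_trans hkm (hS l hl)
  have h := hC.exists_principalMinor_eq_mul (S' := {k}) S (by simpa using hk)
    (fun l hl h => absurd (hge l hl) (not_le.2 h))
    (fun _ _ _ l hl h => absurd (hge l hl) (not_le.2 h))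
    (fun _ _ _ => ⟨k, by simp, hkm⟩) (fun i hi _ l hl _ => by
      rw [mem_singleton.1 hi]
      exact hS l hl)
  rwa [principalMinor_singleton, hC.block₂₂ k k hkm hkm, min_self] at h

theorem principalMinor_mixed (hC : IsCyclops m a b₁ b₂ C) {j k : Fin n} (hj : j ∈ S)
    (hk : k ∈ S) (hjm : (j : ℕ) < m) (hkm : m ≤ (k : ℕ)) (hS : ∀ l ∈ S, l ≤ j ∨ k ≤ l) :
    ∃ c, 0 < c ∧ principalMinor C S = c * (a j * a k - b₁ * b₂) := by
  have hjk : j ≠ k := by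
    rintro rfl
    omega
  have h := hC.exists_principalMinor_eq_mul (S' := {j, k}) S
    (by
      intro x hx
      rcases mem_insert.1 hx with rfl | hx
      · exact hj
      · rwa [mem_singleton.1 hx])
    (fun _ _ _ => ⟨j, by simp, hjm⟩)
    (fun i hi him l hl hlm => by
      rcases mem_insert.1 hi with rfl | hi
      · exact (hS l hl).resolve_right fun h => absurd (le_trans hkm h) (not_le.2 hlm)
      · rw [mem_singleton.1 hi] at him
        omega)
    (fun _ _ _ => ⟨k, by simp, hkm⟩)
    (fun i hi him l hl hlm => by
      rcases mem_insert.1 hi with rfl | hi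
      · omega
      · rw [mem_singleton.1 hi]
        exact (hS l hl).resolve_left fun h => absurd (lt_of_le_of_lt (Fin.le_def.1 h) hjm) (not_lt.2 hlm))
  rwa [principalMinor_pair C hjk, hC.block₁₁ j j hjm hjm, max_self, hC.block₂₂ k k hkm hkm,
    min_self, hC.block₁₂ j k hjm hkm, hC.block₂₁ k j hkm hjm] at h

/-- The shape of a principal minor of a cyclops up to a positive factor, according to the blocks
which the index set `S` meets. -/
theorem principalMinor_cases (hC : IsCyclops m a b₁ b₂ C) (S : Finset (Fin n)) :
    S = ∅ ∨
    (∃ j ∈ S, (j : ℕ) < m ∧ (∀ l ∈ S, l ≤ j) ∧ ∃ c, 0 < c ∧ principalMinor C S = c * a j) ∨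
    (∃ k ∈ S, m ≤ (k : ℕ) ∧ (∀ l ∈ S, k ≤ l) ∧ ∃ c, 0 < c ∧ principalMinor C S = c * a k) ∨
    (∃ j ∈ S, ∃ k ∈ S, (j : ℕ) < m ∧ m ≤ (k : ℕ) ∧ (∀ l ∈ S, l ≤ j ∨ k ≤ l) ∧
      ∃ c, 0 < c ∧ principalMinor C S = c * (a j * a k - b₁ * b₂)) := by
  rcases S.eq_empty_or_nonempty with h | hne
  · exact Or.inl h
  refine Or.inr ?_
  rcases (S.filter fun l : Fin n => (l : ℕ) < m).eq_empty_or_nonempty with hF | hF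
  · have hmin : m ≤ (S.min' hne : ℕ) := not_lt.1 (filter_eq_empty_iff.1 hF (min'_mem S hne))
    have hle : ∀ l ∈ S, S.min' hne ≤ l := fun l hl => min'_le _ _ hl
    exact Or.inr (Or.inl ⟨_, min'_mem S hne, hmin, hle,
      hC.principalMinor_second (min'_mem S hne) hmin hle⟩)
  rcases (S.filter fun l : Fin n => m ≤ (l : ℕ)).eq_empty_or_nonempty with hG | hG
  · have hmax : (S.max' hne : ℕ) < m := not_le.1 (filter_eq_empty_iff.1 hG (max'_mem S hne))
    have hle : ∀ l ∈ S, l ≤ S.max' hne := fun l hl => le_max' _ _ hl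
    exact Or.inl ⟨_, max'_mem S hne, hmax, hle,
      hC.principalMinor_first (max'_mem S hne) hmax hle⟩
  · obtain ⟨hjS, hjm⟩ := mem_filter.1 (max'_mem _ hF)
    obtain ⟨hkS, hkm⟩ := mem_filter.1 (min'_mem _ hG)
    have hle : ∀ l ∈ S, l ≤ (S.filter fun l : Fin n => (l : ℕ) < m).max' hF ∨
        (S.filter fun l : Fin n => m ≤ (l : ℕ)).min' hG ≤ l := fun l hl =>
      (lt_or_ge (l : ℕ) m).imp (fun h => le_max' _ _ (mem_filter.2 ⟨hl, h⟩))
        (fun h => min'_le _ _ (mem_filter.2 ⟨hl, h⟩))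
    exact Or.inr (Or.inr ⟨_, hjS, _, hkS, hjm, hkm, hle,
      hC.principalMinor_mixed hjS hkS hjm hkm hle⟩)

theorem card_le_of_gap {j k : Fin n} (hjk : j < k) (hS : ∀ l ∈ S, l ≤ j ∨ k ≤ l) :
    S.card ≤ n + 1 - ((k : ℕ) - j) := by
  have hsub : S ⊆ (Ioo j k)ᶜ := fun l hl => by
    rw [mem_compl, mem_Ioo, not_and_or, not_lt, not_lt]
    exact hS l hl
  have h := card_le_card hsub
  rw [card_compl, Fintype.card_fin, Fin.card_Ioo] at h
  have : (j : ℕ) < k := hjk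
  omega

/-- The largest index set in which `j` is the last index of the first block and `k` the first index
of the second block leaves out exactly the gap between `j` and `k`. -/
theorem exists_principalMinor_gap (hC : IsCyclops m a b₁ b₂ C) {j k : Fin n}
    (hjm : (j : ℕ) < m) (hkm : m ≤ (k : ℕ)) :
    ∃ S : Finset (Fin n), S.card = n + 1 - ((k : ℕ) - j) ∧
      ∃ c, 0 < c ∧ principalMinor C S = c * (a j * a k - b₁ * b₂) := by
  refine ⟨(Ioo j k)ᶜ, ?_, hC.principalMinor_mixed (by simp) (by simp) hjm hkm fun l hl => ?_⟩
  · rw [card_compl, Fintype.card_fin, Fin.card_Ioo]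
    omega
  · rwa [mem_compl, mem_Ioo, not_and_or, not_lt, not_lt] at hl

theorem card_first (hmn : m ≤ n) : #{l : Fin n | (l : ℕ) < m} = m := by
  rw [Fin.card_filter_val_lt, min_eq_right hmn]

theorem card_second (hmn : m ≤ n) : #{l : Fin n | m ≤ (l : ℕ)} = n - m := by
  have h := card_filter_add_card_filter_not (s := (univ : Finset (Fin n))) fun l => (l : ℕ) < m
  simp only [not_lt, card_first hmn, card_univ, Fintype.card_fin] at h
  omega

/-! ### Signs of the parameters -/

section Eye

variable {p q : Fin n}

theorem exists_det_eq_mul (hC : IsCyclops m a b₁ b₂ C) (hp : (p : ℕ) + 1 = m) (hq : (q : ℕ) = m) :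
    ∃ c, 0 < c ∧ C.det = c * (a p * a q - b₁ * b₂) := by
  rw [← principalMinor_univ]
  refine hC.principalMinor_mixed (mem_univ p) (mem_univ q) (by omega) hq.ge fun l _ => ?_
  rw [Fin.le_def, Fin.le_def]
  omega

theorem det_first (hC : IsCyclops m a b₁ b₂ C) (hp : (p : ℕ) + 1 = m) (hmn : m = n) :
    ∃ c, 0 < c ∧ C.det = c * a p := by
  rw [← principalMinor_univ]
  refine hC.principalMinor_first (mem_univ p) (by omega) fun l _ => ?_
  rw [Fin.le_def]
  omega

theorem det_second (hC : IsCyclops m a b₁ b₂ C) (hq : (q : ℕ) = m) (hm : m = 0) :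
    ∃ c, 0 < c ∧ C.det = c * a q := by
  rw [← principalMinor_univ]
  refine hC.principalMinor_second (mem_univ q) (by omega) fun l _ => ?_
  rw [Fin.le_def]
  omega

/-- Writing `Δ = a p * a q - b₁ * b₂`, the matrix `C` maps `a p e_q - b₁ e_p` to `Δ` times the
indicator of the second block and `a q e_p - b₂ e_q` to `Δ` times the indicator of the first block.
Hence `-b₁ / Δ` and `-b₂ / Δ` are sums of off-diagonal entries of `C⁻¹`. -/
theorem mul_nonneg_of_isZMatrix_inv (hC : IsCyclops m a b₁ b₂ C) (hdet : C.det ≠ 0)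
    (hZ : IsZMatrix C⁻¹) (hp : (p : ℕ) + 1 = m) (hq : (q : ℕ) = m) : 0 ≤ b₁ * b₂ := by
  set Δ := a p * a q - b₁ * b₂
  have hpm : (p : ℕ) < m := by omega
  have hqm : m ≤ (q : ℕ) := hq.ge
  have hinv : ∀ v w : Fin n → ℝ, C *ᵥ v = w → v = C⁻¹ *ᵥ w := by
    rintro v w rfl
    rw [mulVec_mulVec, nonsing_inv_mul C (isUnit_iff_ne_zero.2 hdet), one_mulVec]
  have hmul : ∀ (x y : ℝ) (i : Fin n),
      (C *ᵥ (Pi.single p x + Pi.single q y)) i = C i p * x + C i q * y := by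
    intro x y i
    simp [mulVec_add, mul_comm]
  have hpq : p ≠ q := by
    rintro rfl
    omega
  have hrow : ∀ i : Fin n, ((i : ℕ) < m → C i p = a p ∧ C i q = b₁) ∧
      (m ≤ (i : ℕ) → C i p = b₂ ∧ C i q = a q) := by
    refine fun i => ⟨fun hi => ⟨?_, hC.block₁₂ i q hi hqm⟩, fun hi => ⟨hC.block₂₁ i p hi hpm, ?_⟩⟩
    · rw [hC.block₁₁ i p hi hpm, max_eq_right]
      rw [Fin.le_def]
      omega
    · rw [hC.block₂₂ i q hi hqm, min_eq_right]
      rw [Fin.le_def]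
      omega
  have h1 := hinv (Pi.single p (-b₁) + Pi.single q (a p)) (fun i => if (i : ℕ) < m then 0 else Δ)
    (by
      ext i
      rw [hmul]
      split_ifs with hi
      · rw [((hrow i).1 hi).1, ((hrow i).1 hi).2]
        ring
      · rw [((hrow i).2 (not_lt.1 hi)).1, ((hrow i).2 (not_lt.1 hi)).2]
        ring)
  have h2 := hinv (Pi.single p (a q) + Pi.single q (-b₂)) (fun i => if (i : ℕ) < m then Δ else 0)
    (by
      ext i
      rw [hmul]
      split_ifs with hi
      · rw [((hrow i).1 hi).1, ((hrow i).1 hi).2]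
        ring
      · rw [((hrow i).2 (not_lt.1 hi)).1, ((hrow i).2 (not_lt.1 hi)).2]
        ring)
  have e1 : -b₁ = (∑ k : Fin n, if (k : ℕ) < m then 0 else C⁻¹ p k) * Δ := by
    have h := congrFun h1 p
    simp only [Pi.add_apply, Pi.single_eq_same, Pi.single_eq_of_ne hpq, add_zero] at h
    rw [h, mulVec, dotProduct, sum_mul]
    refine sum_congr rfl fun k _ => ?_
    split_ifs <;> simp
  have e2 : -b₂ = (∑ k : Fin n, if (k : ℕ) < m then C⁻¹ q k else 0) * Δ := by
    have h := congrFun h2 q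
    simp only [Pi.add_apply, Pi.single_eq_same, Pi.single_eq_of_ne hpq.symm, zero_add] at h
    rw [h, mulVec, dotProduct, sum_mul]
    refine sum_congr rfl fun k _ => ?_
    split_ifs <;> simp
  have s1 : (∑ k : Fin n, if (k : ℕ) < m then 0 else C⁻¹ p k) ≤ 0 := sum_nonpos fun k _ => by
    split_ifs with hk
    · exact le_rfl
    · refine hZ p k ?_
      rintro rfl
      exact hk hpm
  have s2 : (∑ k : Fin n, if (k : ℕ) < m then C⁻¹ q k else 0) ≤ 0 := sum_nonpos fun k _ => by
    split_ifs with hk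
    · refine hZ q k ?_
      rintro rfl
      omega
    · exact le_rfl
  have h := mul_nonneg (mul_nonneg_of_nonpos_of_nonpos s1 s2) (mul_self_nonneg Δ)
  rw [← neg_mul_neg, e1, e2]
  linarith

end Eye

end IsCyclops

/-! ### Classification of the inverse -/

section Classification

variable {n m : ℕ} {a : Fin n → ℝ} {b₁ b₂ : ℝ} {C : Matrix (Fin n) (Fin n) ℝ}

theorem minOr_le_of_mem {X : Set ℕ} {d : ℕ} (hd : d ∈ X) : minOr n X ≤ d := by
  rw [minOr, if_pos ⟨d, hd⟩]
  exact Nat.sInf_le hd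

theorem minOr_mem {X : Set ℕ} (h : minOr n X ≤ n) : minOr n X ∈ X := by
  by_cases hX : X.Nonempty
  · rw [minOr, if_pos hX]
    exact Nat.sInf_mem hX
  · rw [minOr, if_neg hX] at h
    omega

theorem card_le_numPosFirst {S : Finset (Fin n)} (hS : ∀ l ∈ S, (l : ℕ) < m ∧ 0 < a l) :
    S.card ≤ numPosFirst m a :=
  card_le_card fun l hl => mem_filter.2 ⟨mem_univ l, hS l hl⟩

theorem card_le_numPosSecond {S : Finset (Fin n)} (hS : ∀ l ∈ S, m ≤ (l : ℕ) ∧ 0 < a l) :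
    S.card ≤ numPosSecond m a :=
  card_le_card fun l hl => mem_filter.2 ⟨mem_univ l, hS l hl⟩

theorem exists_card_eq_numPosFirst (m : ℕ) (a : Fin n → ℝ) :
    ∃ S : Finset (Fin n), S.card = numPosFirst m a ∧ ∀ l ∈ S, (l : ℕ) < m ∧ 0 < a l :=
  ⟨_, rfl, fun _ hl => (mem_filter.1 hl).2⟩

theorem exists_card_eq_numPosSecond (m : ℕ) (a : Fin n → ℝ) :
    ∃ S : Finset (Fin n), S.card = numPosSecond m a ∧ ∀ l ∈ S, m ≤ (l : ℕ) ∧ 0 < a l :=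
  ⟨_, rfl, fun _ hl => (mem_filter.1 hl).2⟩

theorem IsCyclops.principalMinor_nonneg (hC : IsCyclops m a b₁ b₂ C) (hdet : 0 < C.det)
    (hZ : IsZMatrix C⁻¹) (ha : ∀ j : Fin n, (j : ℕ) + 1 = m → 0 < a j) (S : Finset (Fin n)) :
    0 ≤ principalMinor C S := by
  have hmn := hC.eye_le
  have hfirst : ∀ j : Fin n, (j : ℕ) < m → 0 < a j := fun j hj =>
    (ha ⟨m - 1, by omega⟩ (by simp; omega)).trans_le
      (hC.antitone_first (Fin.le_def.2 (by simp; omega)) (by simp; omega))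
  have hsecond : ∀ k : Fin n, m ≤ (k : ℕ) → 0 < a k := by
    intro k hk
    let q : Fin n := ⟨m, by omega⟩
    refine lt_of_lt_of_le ?_ (hC.monotone_second (i := q) (Fin.le_def.2 hk) le_rfl)
    rcases Nat.eq_zero_or_pos m with hm | hm
    · obtain ⟨c, hc, h⟩ := hC.det_second (q := q) rfl hm
      rw [h] at hdet
      exact pos_of_mul_pos_right hdet hc.le
    · have hp : ((⟨m - 1, by omega⟩ : Fin n) : ℕ) + 1 = m := by simp; omega
      obtain ⟨c, hc, h⟩ := hC.exists_det_eq_mul (q := q) hp rfl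
      have hb := hC.mul_nonneg_of_isZMatrix_inv (q := q) hdet.ne' hZ hp rfl
      rw [h] at hdet
      have hΔ := pos_of_mul_pos_right hdet hc.le
      exact pos_of_mul_pos_right (by linarith) (ha _ hp).le
  rcases hC.principalMinor_cases S with rfl | ⟨j, -, hjm, -, c, hc, h⟩ |
    ⟨k, -, hkm, -, c, hc, h⟩ | ⟨j, -, k, -, hjm, hkm, -, c, hc, h⟩
  · rw [principalMinor_empty]
    exact zero_le_one
  · rw [h]
    exact (mul_pos hc (hfirst j hjm)).le
  · rw [h]
    exact (mul_pos hc (hsecond k hkm)).le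
  · rw [h]
    let q : Fin n := ⟨m, by omega⟩
    let p : Fin n := ⟨m - 1, by omega⟩
    have hp : (p : ℕ) + 1 = m := by simp [p]; omega
    obtain ⟨d, hd, h'⟩ := hC.exists_det_eq_mul (q := q) hp rfl
    rw [h'] at hdet
    have hΔ := pos_of_mul_pos_right hdet hd.le
    have hle : a p * a q ≤ a j * a k :=
      mul_le_mul (hC.antitone_first (Fin.le_def.2 (by omega)) (by omega))
        (hC.monotone_second (Fin.le_def.2 hkm) le_rfl) (hsecond q le_rfl).le (hfirst j hjm).le
    exact mul_nonneg hc.le (by linarith)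

/-- In this case `a_m` and `a_{m+1}` are both negative, so the largest negative principal minors
come from the first block, the second block, or the index sets leaving out a minimal gap. -/
theorem IsCyclops.inClassL_of_det_pos (hC : IsCyclops m a b₁ b₂ C) (hdet : 0 < C.det)
    (hZ : IsZMatrix C⁻¹) {p : Fin n} (hp : (p : ℕ) + 1 = m) (hap : a p ≤ 0) {N : ℕ}
    (hN : N = max (max m (n - m)) (n + 1 - minOr n (negGaps m a b₁ b₂))) :
    N < n ∧ InClassL (n - 1 - N) C⁻¹ := by
  have hmn : m < n := by
    refine lt_of_le_of_ne hC.eye_le fun hmn => ?_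
    obtain ⟨c, hc, h⟩ := hC.det_first hp hmn
    rw [h] at hdet
    exact absurd (pos_of_mul_pos_right hdet hc.le) (not_lt.2 hap)
  let q : Fin n := ⟨m, hmn⟩
  have hpos : 0 < a p * a q := by
    obtain ⟨c, hc, h⟩ := hC.exists_det_eq_mul (q := q) hp rfl
    have hb := hC.mul_nonneg_of_isZMatrix_inv (q := q) hdet.ne' hZ hp rfl
    rw [h] at hdet
    have hΔ := pos_of_mul_pos_right hdet hc.le
    linarith
  have hap' : a p < 0 := lt_of_le_of_ne hap fun h => by simp [h] at hpos
  have haq : a q < 0 := neg_of_mul_pos_right hpos hap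
  refine inClassL_inv_of_principalMinor hdet.ne' hZ (fun S hS => ?_) ?_
  · have hneg : principalMinor C S < 0 := neg_of_mul_neg_left hS hdet.le
    rcases hC.principalMinor_cases S with rfl | ⟨j, -, hjm, hle, c, hc, h⟩ |
      ⟨k, -, hkm, hle, c, hc, h⟩ | ⟨j, -, k, -, hjm, hkm, hle, c, hc, h⟩
    · simp
    · have hsub : S ⊆ ({l : Fin n | (l : ℕ) < m} : Finset (Fin n)) := fun l hl =>
        mem_filter.2 ⟨mem_univ l, lt_of_le_of_lt (hle l hl) hjm⟩
      have hcard := card_le_card hsub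
      rw [IsCyclops.card_first hmn.le] at hcard
      omega
    · have hsub : S ⊆ ({l : Fin n | m ≤ (l : ℕ)} : Finset (Fin n)) := fun l hl =>
        mem_filter.2 ⟨mem_univ l, le_trans hkm (hle l hl)⟩
      have hcard := card_le_card hsub
      rw [IsCyclops.card_second hmn.le] at hcard
      omega
    · rw [h] at hneg
      have hmem : (k : ℕ) - j ∈ negGaps m a b₁ b₂ :=
        ⟨j, k, hjm, hkm, neg_of_mul_neg_right hneg hc.le, rfl⟩
      have hx := minOr_le_of_mem (n := n) hmem
      have hcard := IsCyclops.card_le_of_gap (Fin.lt_def.2 (by omega)) hle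
      omega
  · have hcases : N = m ∨ N = n - m ∨
        (minOr n (negGaps m a b₁ b₂) ≤ n ∧ N = n + 1 - minOr n (negGaps m a b₁ b₂)) := by
      omega
    rcases hcases with h | h | ⟨hx, h⟩
    · refine ⟨({l : Fin n | (l : ℕ) < m} : Finset (Fin n)), ?_, ?_⟩
      · rw [h, IsCyclops.card_first hmn.le]
      · obtain ⟨c, hc, h⟩ := hC.principalMinor_first (j := p)
          (S := ({l : Fin n | (l : ℕ) < m} : Finset (Fin n)))
          (mem_filter.2 ⟨mem_univ p, by omega⟩) (by omega) fun l hl => by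
            have := (mem_filter.1 hl).2
            rw [Fin.le_def]
            omega
        rw [h]
        exact mul_neg_of_neg_of_pos (mul_neg_of_pos_of_neg hc hap') hdet
    · refine ⟨({l : Fin n | m ≤ (l : ℕ)} : Finset (Fin n)), ?_, ?_⟩
      · rw [h, IsCyclops.card_second hmn.le]
      · obtain ⟨c, hc, h⟩ := hC.principalMinor_second (k := q)
          (S := ({l : Fin n | m ≤ (l : ℕ)} : Finset (Fin n)))
          (mem_filter.2 ⟨mem_univ q, le_rfl⟩) le_rfl fun l hl => Fin.le_def.2 (mem_filter.1 hl).2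
        rw [h]
        exact mul_neg_of_neg_of_pos (mul_neg_of_pos_of_neg hc haq) hdet
    · obtain ⟨j, k, hjm, hkm, hneg, hd⟩ := minOr_mem hx
      obtain ⟨S, hS, c, hc, hcS⟩ := hC.exists_principalMinor_gap hjm hkm
      refine ⟨S, by rw [hS, h, hd], ?_⟩
      rw [hcS]
      exact mul_neg_of_neg_of_pos (mul_neg_of_pos_of_neg hc hneg) hdet

/-- The largest positive principal minors come from the positive parameters of the first block, of
the second block, or from the index sets leaving out a minimal gap. -/
theorem IsCyclops.inClassL_of_det_neg (hC : IsCyclops m a b₁ b₂ C) (hdet : C.det < 0)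
    (hZ : IsZMatrix C⁻¹) {N : ℕ}
    (hN : N = max (max (numPosFirst m a) (numPosSecond m a))
      (n + 1 - minOr n (posGaps m a b₁ b₂))) :
    N < n ∧ InClassL (n - 1 - N) C⁻¹ := by
  refine inClassL_inv_of_principalMinor hdet.ne hZ (fun S hS => ?_) ?_
  · have hpos : 0 < principalMinor C S := pos_of_mul_neg_left hS hdet.le
    rcases hC.principalMinor_cases S with rfl | ⟨j, -, hjm, hle, c, hc, h⟩ |
      ⟨k, -, hkm, hle, c, hc, h⟩ | ⟨j, -, k, -, hjm, hkm, hle, c, hc, h⟩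
    · simp
    · rw [h] at hpos
      have haj := pos_of_mul_pos_right hpos hc.le
      have hcard : S.card ≤ numPosFirst m a := card_le_numPosFirst fun l hl =>
        ⟨lt_of_le_of_lt (hle l hl) hjm, haj.trans_le (hC.antitone_first (hle l hl) hjm)⟩
      omega
    · rw [h] at hpos
      have hak := pos_of_mul_pos_right hpos hc.le
      have hcard : S.card ≤ numPosSecond m a := card_le_numPosSecond fun l hl =>
        ⟨le_trans hkm (hle l hl), hak.trans_le (hC.monotone_second (hle l hl) hkm)⟩
      omega
    · rw [h] at hpos
      have hmem : (k : ℕ) - j ∈ posGaps m a b₁ b₂ :=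
        ⟨j, k, hjm, hkm, pos_of_mul_pos_right hpos hc.le, rfl⟩
      have hy := minOr_le_of_mem (n := n) hmem
      have hcard := IsCyclops.card_le_of_gap (Fin.lt_def.2 (by omega)) hle
      omega
  · have hcases : N = numPosFirst m a ∨ N = numPosSecond m a ∨
        (minOr n (posGaps m a b₁ b₂) ≤ n ∧ N = n + 1 - minOr n (posGaps m a b₁ b₂)) := by
      omega
    -- index sets without positive parameters are empty, with minor `1`
    rcases hcases with h | h | ⟨hy, h⟩
    · obtain ⟨S, hcard, hS⟩ := exists_card_eq_numPosFirst m a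
      refine ⟨S, hcard.trans h.symm, mul_neg_of_pos_of_neg ?_ hdet⟩
      rcases hC.principalMinor_cases S with rfl | ⟨j, hj, -, -, c, hc, h⟩ |
        ⟨k, hk, hkm, -⟩ | ⟨-, -, k, hk, -, hkm, -⟩
      · rw [principalMinor_empty]
        exact one_pos
      · rw [h]
        exact mul_pos hc (hS j hj).2
      · exact absurd (hS k hk).1 (not_lt.2 hkm)
      · exact absurd (hS k hk).1 (not_lt.2 hkm)
    · obtain ⟨S, hcard, hS⟩ := exists_card_eq_numPosSecond m a
      refine ⟨S, hcard.trans h.symm, mul_neg_of_pos_of_neg ?_ hdet⟩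
      rcases hC.principalMinor_cases S with rfl | ⟨j, hj, hjm, -⟩ |
        ⟨k, hk, -, -, c, hc, h⟩ | ⟨j, hj, -, -, hjm, -⟩
      · rw [principalMinor_empty]
        exact one_pos
      · exact absurd (hS j hj).1 (not_le.2 hjm)
      · rw [h]
        exact mul_pos hc (hS k hk).2
      · exact absurd (hS j hj).1 (not_le.2 hjm)
    · obtain ⟨j, k, hjm, hkm, hpos, hd⟩ := minOr_mem hy
      obtain ⟨S, hS, c, hc, hcS⟩ := hC.exists_principalMinor_gap hjm hkm
      refine ⟨S, by rw [hS, h, hd], ?_⟩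
      rw [hcS]
      exact mul_neg_of_pos_of_neg (mul_pos hc hpos) hdet

end Classification

theorem mainTheorem8 (n m : ℕ) (a : Fin n → ℝ) (b₁ b₂ : ℝ) (C : Matrix (Fin n) (Fin n) ℝ)
    (hC : IsCyclops m a b₁ b₂ C) (hdet : C.det ≠ 0) (hZ : IsZMatrix C⁻¹) :
    -- (i); `j` with `j + 1 = m` is the index of the parameter `a_m`
    (0 < C.det → (∀ j : Fin n, (j : ℕ) + 1 = m → 0 < a j) →
      InClassL n C⁻¹ ∧ IsMMatrix C⁻¹) ∧
    -- (ii)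
    (0 < C.det → (∃ j : Fin n, (j : ℕ) + 1 = m ∧ a j ≤ 0) →
      ∃ s : ℕ, (s : ℤ) = (n : ℤ) - 1 -
          max (max (m : ℤ) ((n : ℤ) - m)) ((n : ℤ) - minOr n (negGaps m a b₁ b₂) + 1) ∧
        InClassL s C⁻¹) ∧
    -- (iii)
    (C.det < 0 →
      ∃ s : ℕ, (s : ℤ) = (n : ℤ) - 1 -
          max (max (numPosFirst m a : ℤ) (numPosSecond m a : ℤ))
            ((n : ℤ) - minOr n (posGaps m a b₁ b₂) + 1) ∧
        InClassL s C⁻¹) := by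
  refine ⟨fun hpos ha => ?_, fun hpos hp => ?_, fun hneg => ?_⟩
  · have h := principalMinor_inv_nonneg hpos (hC.principalMinor_nonneg hpos hZ ha)
    exact ⟨hZ.inClassL le_rfl (fun S _ => h S) fun hn => absurd hn (lt_irrefl n), hZ.isMMatrix h⟩
  · obtain ⟨p, hp, hap⟩ := hp
    obtain ⟨hN, h⟩ := hC.inClassL_of_det_pos hpos hZ hp hap rfl
    exact ⟨_, by have := hC.eye_le; omega, h⟩
  · obtain ⟨hN, h⟩ := hC.inClassL_of_det_neg hneg hZ rfl
    exact ⟨_, by omega, h⟩
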